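/- Let $P$ be a finite poset with least element $\hat 0$ and greatest element $\hat 1$ that is graded with rank function $\rho$ (so $\rho(\hat 0)=0$ and $\rho(y)=\rho(x)+1$ whenever $y$ covers $x$). Suppose that $P$ is binomial, i.e. for every $k$ any two intervals $[x,y]$ and $[u,v]$ of $P$ with $\rho(y)-\rho(x)=\rho(v)-\rho(u)=k$ have the same number of maximal chains, and Eulerian, i.e. every interval $[x,y]$ with $x<y$ contains as many elements of even rank as elements of odd rank. If the rank $n=\rho(\hat 1)$ of $P$ is even and $n=2m\ge 4$, then $P$ is isomorphic either to the butterfly poset $T_n$ or to the boolean lattice $B_n$. Here $B_n$ is the set of all subsets of $\{1,\dots,n\}$ ordered by inclusion, and $T_n$ consists of a least element $\hat 0$, a greatest element $\hat 1$ and the elements $(k,i)$ with $1\le k\le n-1$ and $i\in\{1,2\}$, where $(k,i)<(l,j)$ if and only if $k<l$. -/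

import Mathlib

/-- The number of maximal chains of the interval `[x, y]` of a poset. -/
noncomputable def numMaximalChains {P : Type*} [PartialOrder P] (x y : P) : ℕ :=
  Nat.card (Flag (Set.Icc x y))

/-- `[x, y]` is an `n`-interval of the graded poset `P`: `x ≤ y` and `ρ(y) = ρ(x) + n`, where the
rank function `ρ` is `grade ℕ` (it increases by one along covers and vanishes at minimal
elements). -/
def IsIntervalOfRank {P : Type*} [PartialOrder P] [GradeMinOrder ℕ P] (n : ℕ) (x y : P) : Prop :=
  x ≤ y ∧ grade ℕ y = grade ℕ x + n

/-- A graded poset is binomial if, for every `n`, any two of its `n`-intervals have the same number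
of maximal chains. -/
def IsBinomialPoset (P : Type*) [PartialOrder P] [GradeMinOrder ℕ P] : Prop :=
  ∀ (n : ℕ) (x y u v : P), IsIntervalOfRank n x y → IsIntervalOfRank n u v →
    numMaximalChains x y = numMaximalChains u v

/-- A graded poset is Eulerian if every non-singleton interval `[x, y]` has as many elements of even
rank as elements of odd rank. -/
def IsEulerianPoset (P : Type*) [PartialOrder P] [GradeMinOrder ℕ P] : Prop :=
  ∀ x y : P, x < y →
    {z ∈ Set.Icc x y | Even (grade ℕ z)}.ncard = {z ∈ Set.Icc x y | Odd (grade ℕ z)}.ncard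

/-- The elements of the butterfly poset of rank `n` other than the least and the greatest one: two
elements on each of the `n - 1` levels. -/
@[ext]
structure ButterflyProper (n : ℕ) where
  level : Fin (n - 1)
  side : Fin 2

/-- Two distinct elements are comparable exactly when they are on different levels. -/
instance ButterflyProper.instPartialOrder (n : ℕ) : PartialOrder (ButterflyProper n) where
  le a b := a = b ∨ a.level < b.level
  le_refl a := Or.inl rfl
  le_trans a b c := by
    rintro (rfl | h₁) (rfl | h₂)
    · exact Or.inl rfl
    · exact Or.inr h₂
    · exact Or.inr h₁
    · exact Or.inr (h₁.trans h₂)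
  le_antisymm a b := by
    rintro (rfl | h₁) (h | h₂)
    · rfl
    · rfl
    · exact h.symm
    · exact absurd (h₁.trans h₂) (lt_irrefl _)

/-- The butterfly poset `T_n` of rank `n ≥ 1`: two elements on each rank `1, …, n - 1`, each of them
above everything on lower ranks, together with a least and a greatest element. -/
abbrev ButterflyPoset (n : ℕ) : Type := WithBot (WithTop (ButterflyProper n))

/-- The boolean lattice `B_n`: the subsets of an `n`-element set ordered by inclusion. -/
abbrev BooleanLattice (n : ℕ) : Type := Finset (Fin n)

/-! Let `b k` be the common number of maximal chains of the intervals of rank `k`. Counting these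
chains through a fixed level shows that such an interval has `b k / (b j * b (k - j))` elements of
rank `j`. In particular `b (k + 1) / b k` is its number of atoms when the rank is `k + 1`, hence a
positive integer. The Eulerian condition becomes `∑ (-1) ^ j / (b j * b (k - j)) = 0`. It is vacuous
for odd `k`, the terms cancelling in pairs; for even `k` it is one equation between two consecutive
ratios `c` and `d`.

Rank 2 gives `b 2 = 2`, and rank 4 leaves only `b 3 = 4` or `b 3 = 6`. By induction in steps of two
ranks, the first value forces `b (j + 1) = 2 ^ j` and the second `b j = j!`. The equation bounds
`c`; the remaining spurious solutions die by counting atoms (`ratio_ne_three`, `ratio_mono`). Since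
`n` is even, the induction reaches the top rank.

The function `b` then determines the poset. Powers of two put two elements on each proper level, and
every element lies below the whole next level. Factorials make distinct covers of an element have
exactly one common cover (`common_cover_unique`, `exists_common_cover_of_unique`), and this makes `x
↦ {atoms below x}` an isomorphism onto the subsets of the atoms. -/

section EulerianBinomial

open scoped Classical
open Finset

/-! ### Counting maximal chains by their first step -/

section MaximalChains

variable {P : Type*} [PartialOrder P] [Fintype P]

/-- The elements of the interval `[x, y]` that cover `x`. -/
noncomputable def upperCovers (x y : P) : Finset P := {a | x ⋖ a ∧ a ≤ y}

theorem mem_upperCovers {x y a : P} : a ∈ upperCovers x y ↔ x ⋖ a ∧ a ≤ y := by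
  simp [upperCovers]

theorem upperCovers_subset {x y z : P} (h : y ≤ z) : upperCovers x y ⊆ upperCovers x z :=
  fun _ ha => mem_upperCovers.2 ⟨(mem_upperCovers.1 ha).1, (mem_upperCovers.1 ha).2.trans h⟩

/-- The maximal chains of `[x, y]`, as sets of elements of the whole poset. -/
noncomputable def intervalChains (x y : P) : Finset (Set P) :=
  {s | s ⊆ Set.Icc x y ∧ IsChain (· ≤ ·) s ∧
    ∀ z ∈ Set.Icc x y, (∀ w ∈ s, w ≤ z ∨ z ≤ w) → z ∈ s}

theorem mem_intervalChains {x y : P} {s : Set P} :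
    s ∈ intervalChains x y ↔ s ⊆ Set.Icc x y ∧ IsChain (· ≤ ·) s ∧
      ∀ z ∈ Set.Icc x y, (∀ w ∈ s, w ≤ z ∨ z ≤ w) → z ∈ s := by
  simp [intervalChains]

theorem numMaximalChains_eq_card (x y : P) :
    numMaximalChains x y = #(intervalChains x y) := by
  rw [numMaximalChains, ← Nat.card_eq_finsetCard]
  refine Nat.card_congr
    { toFun := fun s => ⟨Subtype.val '' (s : Set (Set.Icc x y)), ?_⟩
      invFun := fun t => ⟨Subtype.val ⁻¹' t.1, ?_, ?_⟩
      left_inv := fun s => ?_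
      right_inv := fun t => ?_ }
  · rw [mem_intervalChains]
    refine ⟨by rintro _ ⟨z, -, rfl⟩; exact z.2, ?_, fun z hz hc => ?_⟩
    · rintro _ ⟨z, hz, rfl⟩ _ ⟨w, hw, rfl⟩ -
      exact s.le_or_le hz hw
    · refine ⟨⟨z, hz⟩, Flag.mem_iff_forall_le_or_ge.2 fun w hw => ?_, rfl⟩
      exact (hc w ⟨w, hw, rfl⟩).symm
  · intro z hz w hw _
    exact (mem_intervalChains.1 t.2).2.1.total hz hw
  · intro s hs hts
    refine hts.antisymm fun z hz => (mem_intervalChains.1 t.2).2.2 z z.2 fun w hw => ?_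
    exact hs.total (hts (a := ⟨w, (mem_intervalChains.1 t.2).1 hw⟩) hw) hz
  · exact Flag.ext (Set.preimage_image_eq _ Subtype.val_injective)
  · refine Subtype.ext (Set.image_preimage_eq_of_subset ?_)
    rw [Subtype.range_coe]
    exact (mem_intervalChains.1 t.2).1

theorem left_mem_of_mem_intervalChains {x y : P} {s : Set P} (hxy : x ≤ y)
    (hs : s ∈ intervalChains x y) : x ∈ s := by
  rw [mem_intervalChains] at hs
  exact hs.2.2 x ⟨le_rfl, hxy⟩ fun w hw => Or.inr (hs.1 hw).1

theorem right_mem_of_mem_intervalChains {x y : P} {s : Set P} (hxy : x ≤ y)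
    (hs : s ∈ intervalChains x y) : y ∈ s := by
  rw [mem_intervalChains] at hs
  exact hs.2.2 y ⟨hxy, le_rfl⟩ fun w hw => Or.inl (hs.1 hw).2

theorem insert_mem_intervalChains {x a y : P} {t : Set P} (hxa : x ⋖ a) (hay : a ≤ y)
    (ht : t ∈ intervalChains a y) : insert x t ∈ intervalChains x y := by
  have hat := left_mem_of_mem_intervalChains hay ht
  rw [mem_intervalChains] at ht ⊢
  obtain ⟨h₁, h₂, h₃⟩ := ht
  refine ⟨?_, ?_, ?_⟩
  · rintro z (rfl | hz)
    · exact ⟨le_rfl, hxa.le.trans hay⟩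
    · exact ⟨hxa.le.trans (h₁ hz).1, (h₁ hz).2⟩
  · exact h₂.insert fun b hb _ => Or.inl (hxa.le.trans (h₁ hb).1)
  · intro z hz hcomp
    rcases hcomp a (Or.inr hat) with h | h
    · exact Or.inr (h₃ z ⟨h, hz.2⟩ fun w hw => hcomp w (Or.inr hw))
    · rcases hxa.eq_or_eq hz.1 h with rfl | rfl
      · exact Or.inl rfl
      · exact Or.inr hat

theorem exists_eq_insert_of_mem_intervalChains {x y : P} {s : Set P} (hxy : x < y)
    (hs : s ∈ intervalChains x y) :
    ∃ a ∈ upperCovers x y, ∃ t ∈ intervalChains a y, insert x t = s := by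
  have hx := left_mem_of_mem_intervalChains hxy.le hs
  have hy := right_mem_of_mem_intervalChains hxy.le hs
  rw [mem_intervalChains] at hs
  obtain ⟨h₁, h₂, h₃⟩ := hs
  obtain ⟨a, ha⟩ := (Set.toFinite (s \ {x})).exists_minimal ⟨y, hy, hxy.ne'⟩
  have has : a ∈ s := ha.prop.1
  have hax : x < a := lt_of_le_of_ne (h₁ has).1 (Ne.symm ha.prop.2)
  have hmin : ∀ w ∈ s, w ≠ x → a ≤ w := fun w hw hwx =>
    (h₂.total has hw).elim id fun h => ha.le_of_le ⟨hw, hwx⟩ h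
  have hcov : x ⋖ a := by
    refine ⟨hax, fun c hxc hca => ?_⟩
    have hc : c ∈ s := h₃ c ⟨hxc.le, hca.le.trans (h₁ has).2⟩ fun w hw => by
      by_cases hwx : w = x
      · exact Or.inl (hwx ▸ hxc.le)
      · exact Or.inr (hca.le.trans (hmin w hw hwx))
    exact (hmin c hc hxc.ne').not_gt hca
  refine ⟨a, mem_upperCovers.2 ⟨hcov, (h₁ has).2⟩, s \ {x}, ?_, by simp [hx]⟩
  rw [mem_intervalChains]
  refine ⟨fun w hw => ⟨hmin w hw.1 hw.2, (h₁ hw.1).2⟩, h₂.mono Set.sdiff_subset, fun z hz hc => ?_⟩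
  refine ⟨h₃ z ⟨hax.le.trans hz.1, hz.2⟩ fun w hw => ?_, (hax.trans_le hz.1).ne'⟩
  by_cases hwx : w = x
  · exact Or.inl (hwx ▸ hax.le.trans hz.1)
  · exact hc w ⟨hw, hwx⟩

theorem intervalChains_eq_biUnion {x y : P} (hxy : x < y) :
    intervalChains x y =
      (upperCovers x y).biUnion fun a => (intervalChains a y).image (insert x) := by
  ext s
  simp only [mem_biUnion, mem_image]
  constructor
  · exact exists_eq_insert_of_mem_intervalChains hxy
  · rintro ⟨a, ha, t, ht, rfl⟩
    rw [mem_upperCovers] at ha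
    exact insert_mem_intervalChains ha.1 ha.2 ht

theorem notMem_of_mem_intervalChains {x a y : P} {t : Set P} (hxa : x < a)
    (ht : t ∈ intervalChains a y) : x ∉ t := fun h =>
  ((mem_intervalChains.1 ht).1 h).1.not_gt hxa

theorem insert_left_injective {α : Type*} {x : α} {s t : Set α} (hs : x ∉ s) (ht : x ∉ t)
    (h : insert x s = insert x t) : s = t := by
  rw [← Set.insert_sdiff_self_of_notMem hs, h, Set.insert_sdiff_self_of_notMem ht]

/-- A maximal chain of `[x, y]` is `x` added to a maximal chain of `[a, y]` for a unique cover `a`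
of `x`, recovered as the least element after removing `x`. -/
theorem numMaximalChains_eq_sum {x y : P} (hxy : x < y) :
    numMaximalChains x y = ∑ a ∈ upperCovers x y, numMaximalChains a y := by
  simp only [numMaximalChains_eq_card]
  rw [intervalChains_eq_biUnion hxy, card_biUnion]
  · refine sum_congr rfl fun a ha => card_image_of_injOn fun s hs t ht h => ?_
    have hxa := (mem_upperCovers.1 ha).1.lt
    exact insert_left_injective (notMem_of_mem_intervalChains hxa hs)
      (notMem_of_mem_intervalChains hxa ht) h
  · intro a ha b hb hab
    rw [Function.onFun, disjoint_left]
    intro s hs hs'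
    obtain ⟨t, ht, rfl⟩ := mem_image.1 hs
    obtain ⟨t', ht', h⟩ := mem_image.1 hs'
    rw [mem_coe, mem_upperCovers] at ha hb
    have htt := insert_left_injective (notMem_of_mem_intervalChains hb.1.lt ht')
      (notMem_of_mem_intervalChains ha.1.lt ht) h
    subst htt
    have h₁ := left_mem_of_mem_intervalChains ha.2 ht
    have h₂ := left_mem_of_mem_intervalChains hb.2 ht'
    exact hab (le_antisymm ((mem_intervalChains.1 ht).1 h₂).1 ((mem_intervalChains.1 ht').1 h₁).1)

theorem numMaximalChains_self (x : P) : numMaximalChains x x = 1 := by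
  rw [numMaximalChains_eq_card, card_eq_one]
  refine ⟨{x}, ?_⟩
  ext s
  rw [mem_singleton]
  constructor
  · intro hs
    have hx := left_mem_of_mem_intervalChains le_rfl hs
    refine Set.Subset.antisymm ?_ (by simpa using hx)
    simpa using (mem_intervalChains.1 hs).1
  · rintro rfl
    rw [mem_intervalChains]
    simp

theorem upperCovers_nonempty {x y : P} (hxy : x < y) : (upperCovers x y).Nonempty := by
  obtain ⟨a, ha⟩ := hxy.exists_covby_le
  exact ⟨a, mem_upperCovers.2 ha⟩

theorem numMaximalChains_pos {x y : P} (hxy : x ≤ y) : 0 < numMaximalChains x y := by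
  induction x using WellFoundedGT.induction with
  | ind x ih =>
    rcases hxy.eq_or_lt with rfl | hlt
    · simp [numMaximalChains_self]
    · rw [numMaximalChains_eq_sum hlt]
      refine sum_pos (fun a ha => ?_) (upperCovers_nonempty hlt)
      rw [mem_upperCovers] at ha
      exact ih a ha.1.lt ha.2

end MaximalChains

/-! ### Factorial functions, level sizes and the Euler relation -/

section Levels

variable {P : Type*} [PartialOrder P] [GradeMinOrder ℕ P]

theorem CovBy.grade_eq_add_one {x y : P} (h : x ⋖ y) : grade ℕ y = grade ℕ x + 1 :=
  (Order.covBy_iff_add_one_eq.1 (h.grade ℕ)).symm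

theorem eq_of_le_of_grade_le {x y : P} (h : x ≤ y) (hg : grade ℕ y ≤ grade ℕ x) : x = y :=
  h.eq_or_lt.resolve_right fun hlt => (grade_strictMono (𝕆 := ℕ) hlt).not_ge hg

theorem covBy_of_le_of_grade_eq {x y : P} (h : x ≤ y) (hg : grade ℕ y = grade ℕ x + 1) : x ⋖ y :=
  (covBy_iff_lt_covBy_grade (𝕆 := ℕ)).2
    ⟨lt_of_le_of_ne h (by rintro rfl; omega), Order.covBy_iff_add_one_eq.2 hg.symm⟩

/-- `b` is the factorial function of the binomial poset `P`: every interval of rank `k` has `b k`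
maximal chains. -/
def IsFactorialFunction (P : Type*) [PartialOrder P] [GradeMinOrder ℕ P] (b : ℕ → ℕ) : Prop :=
  ∀ (k : ℕ) (x y : P), IsIntervalOfRank k x y → numMaximalChains x y = b k

theorem IsBinomialPoset.exists_isFactorialFunction (hB : IsBinomialPoset P) :
    ∃ b : ℕ → ℕ, IsFactorialFunction P b := by
  have h : ∀ k : ℕ, ∃ c : ℕ, ∀ x y : P, IsIntervalOfRank k x y → numMaximalChains x y = c := by
    intro k
    by_cases h : ∃ x y : P, IsIntervalOfRank k x y
    · obtain ⟨u, v, huv⟩ := h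
      exact ⟨numMaximalChains u v, fun x y hxy => hB k x y u v hxy huv⟩
    -- No interval has this rank, so any value will do.
    · exact ⟨0, fun x y hxy => (h ⟨x, y, hxy⟩).elim⟩
  choose b hb using h
  exact ⟨b, hb⟩

variable [Fintype P]

/-- The elements of rank `j` of the interval `[x, y]`, ranks being counted from `x`. -/
noncomputable def intervalLevel (x y : P) (j : ℕ) : Finset P :=
  {z | x ≤ z ∧ z ≤ y ∧ grade ℕ z = grade ℕ x + j}

theorem mem_intervalLevel {x y z : P} {j : ℕ} :
    z ∈ intervalLevel x y j ↔ x ≤ z ∧ z ≤ y ∧ grade ℕ z = grade ℕ x + j := by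
  simp [intervalLevel]

/-- Every maximal chain meets level `j` exactly once. Induction on `j` peels off the first step of
the chain and exchanges the two sums. -/
theorem sum_intervalLevel_numMaximalChains (j : ℕ) {x y : P} (hxy : x ≤ y)
    (hj : grade ℕ x + j ≤ grade ℕ y) :
    ∑ z ∈ intervalLevel x y j, numMaximalChains x z * numMaximalChains z y =
      numMaximalChains x y := by
  induction j generalizing x with
  | zero =>
    have : intervalLevel x y 0 = {x} := by
      ext z
      rw [mem_intervalLevel, mem_singleton]
      constructor
      · rintro ⟨h, -, hg⟩
        exact (eq_of_le_of_grade_le h (by omega)).symm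
      · rintro rfl
        exact ⟨le_rfl, hxy, rfl⟩
    simp [this, numMaximalChains_self]
  | succ j ih =>
    have hlt : x < y := lt_of_le_of_ne hxy (by rintro rfl; omega)
    rw [numMaximalChains_eq_sum hlt]
    have h₁ : ∀ a ∈ upperCovers x y, numMaximalChains a y =
        ∑ z ∈ intervalLevel a y j, numMaximalChains a z * numMaximalChains z y := by
      intro a ha
      rw [mem_upperCovers] at ha
      have := ha.1.grade_eq_add_one
      exact (ih ha.2 (by omega)).symm
    rw [sum_congr rfl h₁]
    have h₂ : ∀ z ∈ intervalLevel x y (j + 1), numMaximalChains x z * numMaximalChains z y =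
        ∑ a ∈ upperCovers x z, numMaximalChains a z * numMaximalChains z y := by
      intro z hz
      rw [mem_intervalLevel] at hz
      have : x < z := lt_of_le_of_ne hz.1 (by rintro rfl; omega)
      rw [numMaximalChains_eq_sum this, sum_mul]
    rw [sum_congr rfl h₂]
    refine sum_comm' fun z a => ?_
    simp only [mem_upperCovers, mem_intervalLevel]
    constructor
    · rintro ⟨⟨h₁, h₂, h₃⟩, h₄, h₅⟩
      have := h₄.grade_eq_add_one
      exact ⟨⟨h₅, h₂, by omega⟩, h₄, h₅.trans h₂⟩
    · rintro ⟨⟨h₁, h₂, h₃⟩, h₄, h₅⟩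
      have := h₄.grade_eq_add_one
      exact ⟨⟨h₄.le.trans h₁, h₂, by omega⟩, h₄, h₁⟩

namespace IsFactorialFunction

variable {b : ℕ → ℕ} {x y : P} {k c : ℕ}

theorem pos (hb : IsFactorialFunction P b) (hxy : IsIntervalOfRank k x y) : 0 < b k := by
  rw [← hb k x y hxy]
  exact numMaximalChains_pos hxy.1

theorem card_intervalLevel_mul (hb : IsFactorialFunction P b) {j : ℕ}
    (hxy : IsIntervalOfRank k x y) (hj : j ≤ k) :
    #(intervalLevel x y j) * (b j * b (k - j)) = b k := by
  have hg := hxy.2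
  rw [← hb k x y hxy, ← sum_intervalLevel_numMaximalChains j hxy.1 (by omega), card_eq_sum_ones,
    sum_mul]
  refine sum_congr rfl fun z hz => ?_
  rw [mem_intervalLevel] at hz
  rw [hb j x z ⟨hz.1, hz.2.2⟩, hb (k - j) z y ⟨hz.2.1, by omega⟩, one_mul]

theorem card_upperCovers_mul (hb : IsFactorialFunction P b)
    (hxy : IsIntervalOfRank (k + 1) x y) : #(upperCovers x y) * b k = b (k + 1) := by
  have hg := hxy.2
  have hlt : x < y := lt_of_le_of_ne hxy.1 (by rintro rfl; omega)
  rw [← hb (k + 1) x y hxy, numMaximalChains_eq_sum hlt, card_eq_sum_ones, sum_mul]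
  refine sum_congr rfl fun a ha => ?_
  rw [mem_upperCovers] at ha
  have := ha.1.grade_eq_add_one
  rw [hb k a y ⟨ha.2, by omega⟩, one_mul]

theorem exists_intervalLevel (hb : IsFactorialFunction P b) {j : ℕ}
    (hxy : IsIntervalOfRank k x y) (hj : j ≤ k) : ∃ z, z ∈ intervalLevel x y j := by
  have h := hb.card_intervalLevel_mul hxy hj
  have hp := hb.pos hxy
  rw [← h] at hp
  exact card_pos.1 (Nat.pos_of_mul_pos_right hp)

theorem card_upperCovers (hb : IsFactorialFunction P b) (hc : b (k + 1) = c * b k)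
    (hxy : IsIntervalOfRank (k + 1) x y) : #(upperCovers x y) = c := by
  obtain ⟨z, hz⟩ := hb.exists_intervalLevel hxy (Nat.le_succ k)
  rw [mem_intervalLevel] at hz
  have hp := hb.pos (k := k) ⟨hz.1, hz.2.2⟩
  exact Nat.eq_of_mul_eq_mul_right hp ((hb.card_upperCovers_mul hxy).trans hc)

theorem map_zero (hb : IsFactorialFunction P b) (x : P) : b 0 = 1 := by
  rw [← hb 0 x x ⟨le_rfl, rfl⟩, numMaximalChains_self]

theorem map_one (hb : IsFactorialFunction P b) (hxy : IsIntervalOfRank 1 x y) : b 1 = 1 := by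
  rw [← hb.card_upperCovers_mul hxy, hb.map_zero x, mul_one, card_eq_one]
  refine ⟨y, ?_⟩
  have hg := hxy.2
  ext a
  rw [mem_upperCovers, mem_singleton]
  constructor
  · rintro ⟨h₁, h₂⟩
    have := h₁.grade_eq_add_one
    exact eq_of_le_of_grade_le h₂ (by omega)
  · rintro rfl
    exact ⟨covBy_of_le_of_grade_eq hxy.1 hg, le_rfl⟩

end IsFactorialFunction

theorem IsEulerianPoset.sum_card_intervalLevel (hE : IsEulerianPoset P) {x y : P} {k : ℕ}
    (hxy : IsIntervalOfRank k x y) (hk : k ≠ 0) :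
    ∑ j ∈ range (k + 1), (-1 : ℤ) ^ j * #(intervalLevel x y j) = 0 := by
  have hg := hxy.2
  have hlt : x < y := lt_of_le_of_ne hxy.1 (by rintro rfl; omega)
  let I : Finset P := {z | x ≤ z ∧ z ≤ y}
  have h₁ : ∑ z ∈ I, (-1 : ℤ) ^ grade ℕ z = 0 := by
    rw [← sum_filter_add_sum_filter_not I fun z => Even (grade ℕ z)]
    have he : ∀ z ∈ I.filter fun z => Even (grade ℕ z), (-1 : ℤ) ^ grade ℕ z = 1 := fun z hz =>
      (mem_filter.1 hz).2.neg_one_pow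
    have ho : ∀ z ∈ I.filter fun z => ¬ Even (grade ℕ z), (-1 : ℤ) ^ grade ℕ z = -1 := fun z hz =>
      (Nat.not_even_iff_odd.1 (mem_filter.1 hz).2).neg_one_pow
    rw [sum_congr rfl he, sum_congr rfl ho]
    have hcard := hE x y hlt
    have hs : {z ∈ Set.Icc x y | Even (grade ℕ z)} =
        ((I.filter fun z => Even (grade ℕ z) : Finset P) : Set P) := by
      ext z; simp [I]
    have ht : {z ∈ Set.Icc x y | Odd (grade ℕ z)} =
        ((I.filter fun z => ¬ Even (grade ℕ z) : Finset P) : Set P) := by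
      ext z; simp [I]
    rw [hs, ht, Set.ncard_coe_finset, Set.ncard_coe_finset] at hcard
    simp [hcard]
  -- Counting ranks from `x` instead of from the bottom only changes a global sign.
  have h₂ : ∑ z ∈ I, (-1 : ℤ) ^ grade ℕ z =
      (-1) ^ grade ℕ x * ∑ j ∈ range (k + 1), (-1 : ℤ) ^ j * #(intervalLevel x y j) := by
    have hmaps : ∀ z ∈ I, grade ℕ z - grade ℕ x ∈ range (k + 1) := by
      intro z hz
      have := grade_mono (𝕆 := ℕ) (mem_filter.1 hz).2.2
      rw [mem_range]; omega
    rw [← sum_fiberwise_of_maps_to hmaps, mul_sum]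
    refine sum_congr rfl fun j _ => ?_
    have hset : I.filter (fun z => grade ℕ z - grade ℕ x = j) = intervalLevel x y j := by
      ext z
      simp only [I, mem_filter, mem_univ, true_and, mem_intervalLevel]
      constructor
      · rintro ⟨⟨h, h'⟩, h''⟩
        have := grade_mono (𝕆 := ℕ) h
        exact ⟨h, h', by omega⟩
      · rintro ⟨h, h', h''⟩
        exact ⟨⟨h, h'⟩, by omega⟩
    have hval : ∀ z ∈ intervalLevel x y j, (-1 : ℤ) ^ grade ℕ z = (-1) ^ grade ℕ x * (-1) ^ j := by
      intro z hz
      rw [(mem_intervalLevel.1 hz).2.2, pow_add]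
    rw [hset, sum_congr rfl hval, sum_const, nsmul_eq_mul]
    ring
  rw [h₂] at h₁
  exact (mul_eq_zero.1 h₁).resolve_left (pow_ne_zero _ (by norm_num))

theorem IsFactorialFunction.alternating_sum_eq_zero {b : ℕ → ℕ} (hb : IsFactorialFunction P b)
    (hE : IsEulerianPoset P) {x y : P} {k : ℕ} (hxy : IsIntervalOfRank k x y) (hk : k ≠ 0) :
    ∑ j ∈ range (k + 1), (-1 : ℚ) ^ j / (b j * b (k - j)) = 0 := by
  have hpos : (b k : ℚ) ≠ 0 := by exact_mod_cast (hb.pos hxy).ne'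
  have h := hE.sum_card_intervalLevel hxy hk
  have h' : (b k : ℚ) * ∑ j ∈ range (k + 1), (-1 : ℚ) ^ j / (b j * b (k - j)) = 0 := by
    rw [mul_sum, ← Int.cast_zero, ← h, Int.cast_sum]
    refine sum_congr rfl fun j hj => ?_
    have hc := hb.card_intervalLevel_mul hxy (Nat.lt_succ_iff.1 (mem_range.1 hj))
    have hne : b j * b (k - j) ≠ 0 := by
      intro h0
      rw [h0, mul_zero] at hc
      exact (hb.pos hxy).ne hc
    have hne' : (b j * b (k - j) : ℚ) ≠ 0 := by exact_mod_cast hne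
    rw [← hc, ← mul_div_assoc, div_eq_iff hne']
    push_cast
    ring
  exact (mul_eq_zero.1 h').resolve_left hpos

end Levels

/-! ### The Euler relation in even rank as an equation between two ratios -/

section Recursion

/-- The alternating sum of an even rank, with its two first and its two last terms split off. -/
theorem alternating_sum_split (b : ℕ → ℕ) (l : ℕ) (h0 : b 0 = 1) (h1 : b 1 = 1) :
    ∑ j ∈ range (2 * l + 4 + 1), (-1 : ℚ) ^ j / (b j * b (2 * l + 4 - j)) =
      2 / b (2 * l + 4) - 2 / b (2 * l + 3) +
        ∑ i ∈ range (2 * l + 1), (-1 : ℚ) ^ i / (b (i + 2) * b (2 * l + 2 - i)) := by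
  have h₁ : (-1 : ℚ) ^ (2 * l + 4) = 1 := Even.neg_one_pow ⟨l + 2, by ring⟩
  have h₂ : (-1 : ℚ) ^ (2 * l + 1 + 1 + 1) = -1 := Odd.neg_one_pow ⟨l + 1, by ring⟩
  have h₃ : 2 * l + 4 - (2 * l + 1 + 1 + 1) = 1 := by omega
  have h₄ : ∀ i, 2 * l + 4 - (i + 1 + 1) = 2 * l + 2 - i := fun i => by omega
  rw [sum_range_succ, sum_range_succ, sum_range_succ', sum_range_succ']
  simp only [h₁, h₂, h₃, h₄, Nat.sub_self, h0, h1]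
  have h₅ : ∀ i : ℕ, (-1 : ℚ) ^ (i + 1 + 1) = (-1) ^ i := fun i => by ring
  have h₆ : 2 * l + 4 - (0 + 1) = 2 * l + 3 := by omega
  simp only [h₅, h₆]
  norm_num [h0, h1]
  ring

theorem alternating_sum_factorial (n : ℕ) (hn : n ≠ 0) :
    ∑ j ∈ range (n + 1), (-1 : ℚ) ^ j / (j.factorial * (n - j).factorial) = 0 := by
  have h := Int.alternating_sum_range_choose_of_ne hn
  have hn' : (n.factorial : ℚ) ≠ 0 := by exact_mod_cast n.factorial_ne_zero
  have h' : (n.factorial : ℚ) *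
      ∑ j ∈ range (n + 1), (-1 : ℚ) ^ j / (j.factorial * (n - j).factorial) = 0 := by
    rw [mul_sum, ← Int.cast_zero, ← h, Int.cast_sum]
    refine sum_congr rfl fun j hj => ?_
    have hj' : j ≤ n := Nat.lt_succ_iff.1 (mem_range.1 hj)
    push_cast
    rw [Nat.cast_choose ℚ hj']
    ring
  exact (mul_eq_zero.1 h').resolve_left hn'

theorem ratio_relation_of_two_pow {b : ℕ → ℕ} {l c d : ℕ} (h0 : b 0 = 1)
    (hpow : ∀ j ≤ 2 * l + 1, b (j + 1) = 2 ^ j) (hc : b (2 * l + 3) = c * b (2 * l + 2))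
    (hd : b (2 * l + 4) = d * b (2 * l + 3)) (hc0 : c ≠ 0) (hd0 : d ≠ 0)
    (hsum : ∑ j ∈ range (2 * l + 4 + 1), (-1 : ℚ) ^ j / (b j * b (2 * l + 4 - j)) = 0) :
    d * c + 4 = 4 * d := by
  rw [alternating_sum_split b l h0 (hpow 0 (by omega))] at hsum
  have hmid : ∑ i ∈ range (2 * l + 1), (-1 : ℚ) ^ i / (b (i + 2) * b (2 * l + 2 - i)) =
      1 / 2 ^ (2 * l + 2) := by
    have : ∀ i ∈ range (2 * l + 1), (-1 : ℚ) ^ i / (b (i + 2) * b (2 * l + 2 - i)) =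
        (-1) ^ i * (1 / 2 ^ (2 * l + 2)) := by
      intro i hi
      rw [mem_range] at hi
      have h₁ : b (2 * l + 2 - i) = 2 ^ (2 * l + 1 - i) := by
        rw [← hpow _ (Nat.sub_le _ _)]
        congr 1; omega
      have h₂ : (i + 1) + (2 * l + 1 - i) = 2 * l + 2 := by omega
      rw [hpow (i + 1) (by omega), h₁]
      push_cast
      rw [← pow_add, h₂, mul_one_div]
    -- There are `2 * l + 1` middle terms, equal up to alternating signs, so all but one cancel.
    rw [sum_congr rfl this, ← sum_mul, neg_one_geom_sum, if_neg (by simp), one_mul]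
  rw [hmid, hd, hc, hpow _ le_rfl] at hsum
  have hc' : (c : ℚ) ≠ 0 := by exact_mod_cast hc0
  have hd' : (d : ℚ) ≠ 0 := by exact_mod_cast hd0
  push_cast at hsum
  rw [pow_succ (2 : ℚ) (2 * l + 1)] at hsum
  have hp : (2 : ℚ) ^ (2 * l + 1) ≠ 0 := by positivity
  field_simp at hsum
  have : (d * c + 4 : ℚ) = 4 * d := by linarith
  exact_mod_cast this

/-- The factorials satisfy the same Euler relation with the same middle terms, so comparing the
outer terms eliminates the middle sum `M`. -/
theorem ratio_relation_of_factorial {b : ℕ → ℕ} {l c d : ℕ}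
    (hfac : ∀ j ≤ 2 * l + 2, b j = j.factorial) (hc : b (2 * l + 3) = c * b (2 * l + 2))
    (hd : b (2 * l + 4) = d * b (2 * l + 3)) (hc0 : c ≠ 0) (hd0 : d ≠ 0)
    (hsum : ∑ j ∈ range (2 * l + 4 + 1), (-1 : ℚ) ^ j / (b j * b (2 * l + 4 - j)) = 0) :
    d * c + (2 * l + 4) = (2 * l + 4) * d := by
  have hsum' := alternating_sum_factorial (2 * l + 4) (by omega)
  rw [alternating_sum_split b l (hfac 0 (by omega)) (hfac 1 (by omega))] at hsum
  rw [alternating_sum_split Nat.factorial l rfl rfl] at hsum'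
  have hmid : ∑ i ∈ range (2 * l + 1), (-1 : ℚ) ^ i / (b (i + 2) * b (2 * l + 2 - i)) =
      ∑ i ∈ range (2 * l + 1), (-1 : ℚ) ^ i /
        ((i + 2).factorial * (2 * l + 2 - i).factorial) := by
    refine sum_congr rfl fun i hi => ?_
    rw [mem_range] at hi
    rw [hfac (i + 2) (by omega), hfac (2 * l + 2 - i) (by omega)]
  rw [hmid, hd, hc, hfac _ le_rfl] at hsum
  rw [show 2 * l + 4 = (2 * l + 2) + 1 + 1 from rfl, show 2 * l + 3 = (2 * l + 2) + 1 from rfl,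
    Nat.factorial_succ, Nat.factorial_succ] at hsum'
  have hc' : (c : ℚ) ≠ 0 := by exact_mod_cast hc0
  have hd' : (d : ℚ) ≠ 0 := by exact_mod_cast hd0
  have hp : ((2 * l + 2).factorial : ℚ) ≠ 0 := by exact_mod_cast Nat.factorial_ne_zero _
  generalize ((2 * l + 2).factorial) = p at *
  generalize ∑ i ∈ range (2 * l + 1), (-1 : ℚ) ^ i /
        ((i + 2).factorial * (2 * l + 2 - i).factorial) = M at *
  push_cast at hsum hsum'
  have h₁ : (2 * l + 3 + 1 : ℚ) ≠ 0 := by positivity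
  have h₂ : (2 * l + 2 + 1 : ℚ) ≠ 0 := by positivity
  have hM : M * p = 2 / (2 * l + 4) := by
    have : M = 2 / ((2 * l + 2 + 1) * p) - 2 / ((2 * l + 3 + 1) * ((2 * l + 2 + 1) * p)) := by
      linarith
    rw [this]
    field_simp
    ring
  have hM' : M * p = 2 / c - 2 / (d * c) := by
    have : M = 2 / (c * p) - 2 / (d * (c * p)) := by linarith
    rw [this]
    field_simp
  rw [hM] at hM'
  have h₃ : (2 * l + 4 : ℚ) ≠ 0 := by positivity
  field_simp at hM'
  have : (d * c + (2 * l + 4) : ℚ) = (2 * l + 4) * d := by linarith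
  exact_mod_cast this

end Recursion

/-! ### Determination of the factorial function -/

section FactorialFunction

variable {P : Type*} [PartialOrder P] [Fintype P] [GradeMinOrder ℕ P] {b : ℕ → ℕ}

namespace IsFactorialFunction

/-- With three atoms, `[x, y]` has an atom `a` outside a rank 3 subinterval `[x, w]`. For `s`
covering `a`, the two atoms below `s` and the two below `w` share some `e`. As `[e, w]` and `[e, y]`
both have two atoms, these coincide, so `a ≤ s ≤ w`. -/
theorem ratio_ne_three (hb : IsFactorialFunction P b) {k c : ℕ} {x y : P}
    (hxy : IsIntervalOfRank (k + 4) x y) (h₂ : b 2 = 2 * b 1) (h₃ : b 3 = 2 * b 2)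
    (hk : b (k + 3) = 2 * b (k + 2)) (hc : b (k + 4) = c * b (k + 3)) : c ≠ 3 := by
  rintro rfl
  have hg := hxy.2
  have hcard := hb.card_upperCovers hc hxy
  obtain ⟨w, hw⟩ := hb.exists_intervalLevel (j := 3) hxy (by omega)
  obtain ⟨hxw, hwy, hgw⟩ := mem_intervalLevel.1 hw
  have hcw : #(upperCovers x w) = 2 := hb.card_upperCovers h₃ ⟨hxw, hgw⟩
  obtain ⟨a, ha, haw⟩ := exists_mem_notMem_of_card_lt_card
    (by omega : #(upperCovers x w) < #(upperCovers x y))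
  obtain ⟨hxa, hay⟩ := mem_upperCovers.1 ha
  have hga := hxa.grade_eq_add_one
  obtain ⟨s, hs⟩ := upperCovers_nonempty (lt_of_le_of_ne hay (by rintro rfl; omega))
  obtain ⟨has, hsy⟩ := mem_upperCovers.1 hs
  have hgs := has.grade_eq_add_one
  have hcs : #(upperCovers x s) = 2 :=
    hb.card_upperCovers h₂ ⟨hxa.le.trans has.le, by omega⟩
  have hne : (upperCovers x w ∩ upperCovers x s).Nonempty := by
    rw [← card_pos]
    have h := card_union_add_card_inter (upperCovers x w) (upperCovers x s)
    have h' := card_le_card (union_subset (upperCovers_subset hwy) (upperCovers_subset hsy) :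
      upperCovers x w ∪ upperCovers x s ⊆ upperCovers x y)
    omega
  obtain ⟨e, he⟩ := hne
  rw [mem_inter, mem_upperCovers, mem_upperCovers] at he
  obtain ⟨⟨hxe, hew⟩, -, hes⟩ := he
  have hge := hxe.grade_eq_add_one
  have hcew : #(upperCovers e w) = 2 := hb.card_upperCovers h₂ ⟨hew, by omega⟩
  have hcey : #(upperCovers e y) = 2 := hb.card_upperCovers hk ⟨hew.trans hwy, by omega⟩
  have heq := eq_of_subset_of_card_le (upperCovers_subset (x := e) hwy) (by omega)
  have hse : s ∈ upperCovers e y :=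
    mem_upperCovers.2 ⟨covBy_of_le_of_grade_eq hes (by omega), hsy⟩
  rw [← heq] at hse
  exact haw (mem_upperCovers.2 ⟨hxa, has.le.trans (mem_upperCovers.1 hse).2⟩)

variable [BoundedOrder P] {n : ℕ}

theorem exists_isIntervalOfRank (hb : IsFactorialFunction P b) (hrank : grade ℕ (⊤ : P) = n)
    {k : ℕ} (hk : k ≤ n) : ∃ z : P, IsIntervalOfRank k ⊥ z := by
  have hbot : grade ℕ (⊥ : P) = 0 := grade_bot
  obtain ⟨z, hz⟩ := hb.exists_intervalLevel (k := n) (x := (⊥ : P)) (y := ⊤)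
    ⟨bot_le, by omega⟩ hk
  exact ⟨z, bot_le, (mem_intervalLevel.1 hz).2.2⟩

theorem exists_ratio (hb : IsFactorialFunction P b) (hrank : grade ℕ (⊤ : P) = n)
    {k : ℕ} (hk : k + 1 ≤ n) : ∃ c : ℕ, c ≠ 0 ∧ b (k + 1) = c * b k := by
  obtain ⟨z, hz⟩ := hb.exists_isIntervalOfRank hrank hk
  have h := hb.card_upperCovers_mul hz
  refine ⟨_, ?_, h.symm⟩
  intro h0
  rw [h0, zero_mul] at h
  exact (hb.pos hz).ne h

theorem ratio_mono (hb : IsFactorialFunction P b) (hrank : grade ℕ (⊤ : P) = n)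
    {k c d : ℕ} (hk : k + 2 ≤ n) (hc : b (k + 1) = c * b k) (hd : b (k + 2) = d * b (k + 1)) :
    c ≤ d := by
  obtain ⟨z, hz⟩ := hb.exists_isIntervalOfRank hrank hk
  obtain ⟨w, hw⟩ := hb.exists_intervalLevel (j := k + 1) hz (by omega)
  obtain ⟨hxw, hwz, hgw⟩ := mem_intervalLevel.1 hw
  rw [← hb.card_upperCovers hd hz, ← hb.card_upperCovers hc ⟨hxw, hgw⟩]
  exact card_le_card (upperCovers_subset hwz)

theorem map_two (hb : IsFactorialFunction P b) (hE : IsEulerianPoset P)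
    (hrank : grade ℕ (⊤ : P) = n) (hn : 2 ≤ n) : b 2 = 2 := by
  obtain ⟨y, hy⟩ := hb.exists_isIntervalOfRank hrank (k := 1) (by omega)
  obtain ⟨z, hz⟩ := hb.exists_isIntervalOfRank hrank hn
  have h := hb.alternating_sum_eq_zero hE hz (by omega)
  have h2 : (b 2 : ℚ) ≠ 0 := by exact_mod_cast (hb.pos hz).ne'
  simp [sum_range_succ, hb.map_zero ⊥, hb.map_one hy] at h
  have : (b 2 : ℚ) = 2 := by
    field_simp at h
    linarith
  exact_mod_cast this

theorem eq_two_pow (hb : IsFactorialFunction P b) (hE : IsEulerianPoset P)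
    (hrank : grade ℕ (⊤ : P) = n) (h₃ : b 3 = 4) (l : ℕ) (hl : 2 * l + 2 ≤ n) :
    ∀ j ≤ 2 * l + 1, b (j + 1) = 2 ^ j := by
  obtain ⟨y, hy⟩ := hb.exists_isIntervalOfRank hrank (k := 1) (by omega)
  have h1 := hb.map_one hy
  have h2 := hb.map_two hE hrank (by omega)
  induction l with
  | zero =>
    intro j hj
    interval_cases j <;> simp [h1, h2]
  | succ l ih =>
    have ih := ih (by omega)
    obtain ⟨c, hc0, hc⟩ := hb.exists_ratio hrank (k := 2 * l + 2) (by omega)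
    obtain ⟨d, hd0, hd⟩ := hb.exists_ratio hrank (k := 2 * l + 3) (by omega)
    obtain ⟨z, hz⟩ := hb.exists_isIntervalOfRank hrank (k := 2 * l + 4) (by omega)
    have hrel := ratio_relation_of_two_pow (hb.map_zero ⊥) ih hc hd hc0 hd0
      (hb.alternating_sum_eq_zero hE hz (by omega))
    -- The relation `d * (4 - c) = 4` also has the solution `c = 3`, `d = 4`.
    have hc3 : c ≠ 3 := by
      rcases l with _ | l
      -- Here `c` is the ratio in rank 3, too short for `ratio_ne_three`; the value of `b 3` settles
      -- it.
      · simp only [mul_zero, zero_add, h₃, h2] at hc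
        omega
      · obtain ⟨w, hw⟩ := hb.exists_isIntervalOfRank hrank (k := (2 * l + 1) + 4) (by omega)
        refine hb.ratio_ne_three hw (by omega) (by omega) ?_ hc
        have e₁ := ih (2 * l + 2) (by omega)
        have e₂ := ih (2 * l + 3) (by omega)
        rw [show 2 * l + 1 + 3 = 2 * l + 3 + 1 from rfl, e₂,
          show 2 * l + 1 + 2 = 2 * l + 2 + 1 from rfl, e₁]
        ring
    have hc4 : c < 4 := by
      by_contra h
      have := Nat.mul_le_mul_left d (not_lt.1 h)
      omega
    have hc2 : c = 2 := by interval_cases c <;> omega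
    subst hc2
    have hd2 : d = 2 := by omega
    subst hd2
    have e := ih (2 * l + 1) le_rfl
    have e₁ : b (2 * l + 2 + 1) = 2 ^ (2 * l + 2) := by rw [hc, e]; ring
    have e₂ : b (2 * l + 3 + 1) = 2 ^ (2 * l + 3) := by
      rw [hd, show 2 * l + 3 = 2 * l + 2 + 1 from rfl, e₁]; ring
    intro j hj
    rcases (by omega : j ≤ 2 * l + 1 ∨ j = 2 * l + 2 ∨ j = 2 * l + 3) with h | rfl | rfl
    · exact ih j h
    · exact e₁
    · exact e₂

theorem eq_factorial (hb : IsFactorialFunction P b) (hE : IsEulerianPoset P)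
    (hrank : grade ℕ (⊤ : P) = n) (h₃ : b 3 = 6) (l : ℕ) (hl : 2 * l + 2 ≤ n) :
    ∀ j ≤ 2 * l + 2, b j = j.factorial := by
  obtain ⟨y, hy⟩ := hb.exists_isIntervalOfRank hrank (k := 1) (by omega)
  have h0 := hb.map_zero ⊥
  have h1 := hb.map_one hy
  have h2 := hb.map_two hE hrank (by omega)
  induction l with
  | zero =>
    intro j hj
    interval_cases j <;> simp [h0, h1, h2]
  | succ l ih =>
    have ih := ih (by omega)
    obtain ⟨c, hc0, hc⟩ := hb.exists_ratio hrank (k := 2 * l + 2) (by omega)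
    obtain ⟨d, hd0, hd⟩ := hb.exists_ratio hrank (k := 2 * l + 3) (by omega)
    obtain ⟨z, hz⟩ := hb.exists_isIntervalOfRank hrank (k := 2 * l + 4) (by omega)
    have hrel := ratio_relation_of_factorial ih hc hd hc0 hd0
      (hb.alternating_sum_eq_zero hE hz (by omega))
    have hcd := hb.ratio_mono hrank (by omega) hc hd
    have e := ih (2 * l + 2) le_rfl
    -- The previous ratio, known by induction, bounds `c` from below.
    have hcl : 2 * l + 2 ≤ c := by
      refine hb.ratio_mono hrank (k := 2 * l + 1) (by omega) ?_ hc
      rw [show 2 * l + 1 + 1 = 2 * l + 2 from rfl, e, ih (2 * l + 1) (by omega)]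
      rfl
    have hcu : c < 2 * l + 4 := by
      by_contra h
      have := Nat.mul_le_mul_left d (not_lt.1 h)
      rw [mul_comm d (2 * l + 4)] at this
      omega
    -- This value would give `d = l + 2`, and `c ≤ d` then leaves only `l = 0`, where `b 3 = 6`
    -- means `c = 3`.
    have hcne : c ≠ 2 * l + 2 := by
      rintro rfl
      have hdl : d = l + 2 := by linarith
      have : l = 0 := by omega
      subst this
      simp only [mul_zero, zero_add, h₃, h2] at hc
      omega
    obtain rfl : c = 2 * l + 3 := by omega
    obtain rfl : d = 2 * l + 4 := by linarith
    have e₁ : b (2 * l + 3) = (2 * l + 3).factorial := by rw [hc, e]; rfl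
    have e₂ : b (2 * l + 4) = (2 * l + 4).factorial := by rw [hd, e₁]; rfl
    intro j hj
    rcases (by omega : j ≤ 2 * l + 2 ∨ j = 2 * l + 3 ∨ j = 2 * l + 4) with h | rfl | rfl
    · exact ih j h
    · exact e₁
    · exact e₂

/-- This is the relation `d * (4 - c) = 4` in rank 4: `c = 1` fails by divisibility, leaving `c = 2`
and `c = 3`. -/
theorem map_three (hb : IsFactorialFunction P b) (hE : IsEulerianPoset P)
    (hrank : grade ℕ (⊤ : P) = n) (hn : 4 ≤ n) : b 3 = 4 ∨ b 3 = 6 := by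
  obtain ⟨y, hy⟩ := hb.exists_isIntervalOfRank hrank (k := 1) (by omega)
  have h2 := hb.map_two hE hrank (by omega)
  obtain ⟨c, hc0, hc⟩ := hb.exists_ratio hrank (k := 2) (by omega)
  obtain ⟨d, hd0, hd⟩ := hb.exists_ratio hrank (k := 3) (by omega)
  obtain ⟨z, hz⟩ := hb.exists_isIntervalOfRank hrank hn
  have hrel := ratio_relation_of_two_pow (l := 0) (hb.map_zero ⊥)
    (fun j hj => by interval_cases j <;> simp [hb.map_one hy, h2]) hc hd hc0 hd0
    (hb.alternating_sum_eq_zero hE hz (by omega))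
  have hc4 : c < 4 := by
    by_contra h
    have := Nat.mul_le_mul_left d (not_lt.1 h)
    omega
  change b 3 = c * b 2 at hc
  rw [h2] at hc
  interval_cases c <;> omega

end IsFactorialFunction

end FactorialFunction

/-! ### Powers of two give the butterfly poset -/

section Butterfly

variable {P : Type*} [PartialOrder P] [Fintype P] [GradeMinOrder ℕ P] [BoundedOrder P]
  {b : ℕ → ℕ} {n : ℕ}

namespace IsFactorialFunction

theorem card_grade_eq_two (hb : IsFactorialFunction P b) (hrank : grade ℕ (⊤ : P) = n)
    (hpow : ∀ j < n, b (j + 1) = 2 ^ j) {j : ℕ} (hj : j + 1 < n) :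
    #({z | grade ℕ z = j + 1} : Finset P) = 2 := by
  have hbot : grade ℕ (⊥ : P) = 0 := grade_bot
  have hlev : ({z | grade ℕ z = j + 1} : Finset P) = intervalLevel ⊥ ⊤ (j + 1) := by
    ext z
    simp [mem_intervalLevel, hbot]
  have h := hb.card_intervalLevel_mul (k := n) (x := (⊥ : P)) (y := ⊤) (j := j + 1)
    ⟨bot_le, by omega⟩ hj.le
  obtain ⟨i, rfl⟩ : ∃ i, n = (j + 1) + (i + 1) := ⟨n - (j + 1) - 1, by omega⟩
  rw [show j + 1 + (i + 1) - (j + 1) = i + 1 by omega, hpow j (by omega), hpow i (by omega),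
    show j + 1 + (i + 1) = (j + i + 1) + 1 by omega, hpow _ (by omega), ← pow_add,
    pow_succ'] at h
  rw [hlev]
  exact Nat.eq_of_mul_eq_mul_right (pow_pos two_pos _) h

/-- Below the last two ranks an element has two covers and the next level has two elements, so it
lies below all of that level; climbing through covers does the rest. -/
theorem lt_of_grade_lt (hb : IsFactorialFunction P b) (hrank : grade ℕ (⊤ : P) = n)
    (hpow : ∀ j < n, b (j + 1) = 2 ^ j) {x y : P} (hxy : grade ℕ x < grade ℕ y) : x < y := by
  induction x using WellFoundedGT.induction with
  | ind x ih =>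
    have hyn : grade ℕ y ≤ n := hrank ▸ grade_mono (𝕆 := ℕ) (le_top : y ≤ ⊤)
    have hx : x < ⊤ := lt_of_le_of_ne le_top (by rintro rfl; omega)
    by_cases h : grade ℕ x + 1 < grade ℕ y
    · obtain ⟨a, ha⟩ := upperCovers_nonempty hx
      obtain ⟨hxa, -⟩ := mem_upperCovers.1 ha
      have := hxa.grade_eq_add_one
      exact hxa.lt.trans (ih a hxa.lt (by omega))
    · have hg : grade ℕ y = grade ℕ x + 1 := by omega
      rcases eq_or_lt_of_le hyn with hn | hn
      · have : y = ⊤ := eq_of_le_of_grade_le le_top (by omega)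
        rwa [this]
      · obtain ⟨i, hi⟩ : ∃ i, n = grade ℕ x + (i + 2) := ⟨n - grade ℕ x - 2, by omega⟩
        have hc : #(upperCovers x ⊤) = 2 := by
          refine hb.card_upperCovers (k := i + 1) ?_ ⟨le_top, by omega⟩
          rw [hpow (i + 1) (by omega), hpow i (by omega), pow_succ']
        have hsub : upperCovers x ⊤ ⊆ ({z | grade ℕ z = grade ℕ x + 1} : Finset P) := by
          intro a ha
          simpa using (mem_upperCovers.1 ha).1.grade_eq_add_one
        have heq := eq_of_subset_of_card_le hsub
          (by rw [hc, hb.card_grade_eq_two hrank hpow (by omega)])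
        have hy : y ∈ upperCovers x ⊤ := by
          rw [heq]
          simpa using hg
        exact (mem_upperCovers.1 hy).1.lt

theorem nonempty_orderIso_butterflyPoset (hb : IsFactorialFunction P b)
    (hrank : grade ℕ (⊤ : P) = n) (hpow : ∀ j < n, b (j + 1) = 2 ^ j) (hn : n ≠ 0) :
    Nonempty (P ≃o ButterflyPoset n) := by
  have hbot : grade ℕ (⊥ : P) = 0 := grade_bot
  have hlt : ∀ {x y : P}, x < y ↔ grade ℕ x < grade ℕ y :=
    ⟨fun h => grade_strictMono h, hb.lt_of_grade_lt hrank hpow⟩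
  -- The labelling of each level is arbitrary: comparability depends only on the ranks.
  let e : ∀ j : Fin (n - 1), ({z | grade ℕ z = j + 1} : Finset P) ≃ Fin 2 := fun j =>
    equivFinOfCardEq (hb.card_grade_eq_two hrank hpow (by have := j.2; omega))
  let g : ButterflyProper n → P := fun p => (e p.level).symm p.side
  have hg : ∀ p, grade ℕ (g p) = p.level + 1 := fun p =>
    (mem_filter.1 ((e p.level).symm p.side).2).2
  have hgle : ∀ p q, g p ≤ g q ↔ p ≤ q := by
    intro p q
    have hle : p ≤ q ↔ p = q ∨ p.level < q.level := Iff.rfl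
    rw [hle, le_iff_eq_or_lt, hlt, hg, hg, Nat.add_lt_add_iff_right, Fin.lt_def]
    refine or_congr ⟨fun h => ?_, fun h => h ▸ rfl⟩ Iff.rfl
    have hl : p.level = q.level := by
      have h' := congrArg (grade ℕ) h
      rw [hg, hg] at h'
      exact Fin.ext (by omega)
    obtain ⟨i, s⟩ := p
    obtain ⟨i', s'⟩ := q
    obtain rfl : i = i' := hl
    exact congrArg _ ((e i).symm.injective (Subtype.ext h))
  have hgtop : ∀ p, ¬ (⊤ : P) ≤ g p := fun p h => by
    have := grade_mono (𝕆 := ℕ) h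
    have := hg p
    have := p.level.2
    omega
  have hgbot : ∀ p, ¬ g p ≤ (⊥ : P) := fun p h => by
    have := grade_mono (𝕆 := ℕ) h
    have := hg p
    omega
  have htb : ¬ (⊤ : P) ≤ ⊥ := fun h => by
    have := grade_mono (𝕆 := ℕ) h
    omega
  let f : ButterflyPoset n → P := WithBot.recBotCoe ⊥ (WithTop.recTopCoe ⊤ g)
  have hft : f ((⊤ : WithTop (ButterflyProper n)) : ButterflyPoset n) = ⊤ := rfl
  have hfg : ∀ p : ButterflyProper n,
      f ((p : WithTop (ButterflyProper n)) : ButterflyPoset n) = g p := fun _ => rfl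
  have hfb : f ⊥ = ⊥ := rfl
  have hf : ∀ u v, f u ≤ f v ↔ u ≤ v := by
    intro u v
    induction u using WithBot.recBotCoe with
    | bot => simp [hfb]
    | coe u =>
      induction v using WithBot.recBotCoe with
      | bot =>
        refine iff_of_false ?_ (WithBot.not_coe_le_bot u)
        induction u using WithTop.recTopCoe with
        | top => exact htb
        | coe u => exact hgbot u
      | coe v =>
        rw [WithBot.coe_le_coe]
        induction v using WithTop.recTopCoe with
        | top => exact iff_of_true (hft ▸ le_top) le_top
        | coe v =>
          induction u using WithTop.recTopCoe with
          | top => exact iff_of_false (hgtop v) (WithTop.not_top_le_coe v)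
          | coe u => rw [hfg, hfg, hgle, WithTop.coe_le_coe]
  have hsurj : Function.Surjective f := by
    intro x
    by_cases hx0 : grade ℕ x = 0
    · exact ⟨⊥, eq_of_le_of_grade_le bot_le (by omega)⟩
    by_cases hxn : grade ℕ x = n
    · exact ⟨_, hft.trans (eq_of_le_of_grade_le le_top (by omega) : x = ⊤).symm⟩
    have hxn' : grade ℕ x ≤ n := hrank ▸ grade_mono (𝕆 := ℕ) (le_top : x ≤ ⊤)
    let j : Fin (n - 1) := ⟨grade ℕ x - 1, by omega⟩
    have hx : x ∈ ({z | grade ℕ z = j + 1} : Finset P) := by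
      simp only [mem_filter, mem_univ, true_and, j]
      omega
    refine ⟨_, (hfg ⟨j, e j ⟨x, hx⟩⟩).trans ?_⟩
    exact congrArg Subtype.val ((e j).symm_apply_apply ⟨x, hx⟩)
  exact ⟨(RelIso.ofSurjective (OrderEmbedding.ofMapLEIff f hf) hsurj).symm⟩

end IsFactorialFunction

end Butterfly

/-! ### Factorials give the boolean lattice -/

section Boolean

variable {P : Type*} [PartialOrder P] [Fintype P] [GradeMinOrder ℕ P] {b : ℕ → ℕ}

namespace IsFactorialFunction

theorem card_upperCovers_eq_rank (hb : IsFactorialFunction P b)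
    {k : ℕ} (hfac : ∀ j ≤ k, b j = j.factorial) {x y : P}
    (hxy : IsIntervalOfRank k x y) : #(upperCovers x y) = k := by
  rcases k with _ | k
  · obtain rfl : x = y := eq_of_le_of_grade_le hxy.1 hxy.2.le
    rw [card_eq_zero, eq_empty_iff_forall_notMem]
    intro a ha
    rw [mem_upperCovers] at ha
    exact ha.2.not_gt ha.1.lt
  · refine hb.card_upperCovers ?_ hxy
    rw [hfac _ le_rfl, hfac k (by omega), Nat.factorial_succ]

/-- Such an interval has three atoms and three coatoms. If `a` and `a'` had two common covers, the
third atom `c` would lie below neither, and its own two covers would make four coatoms. -/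
theorem common_cover_unique_of_rank_three (hb : IsFactorialFunction P b)
    (hfac : ∀ j ≤ 3, b j = j.factorial) {x y : P} (hxy : IsIntervalOfRank 3 x y) {a a' z z' : P}
    (ha : a ∈ upperCovers x y) (ha' : a' ∈ upperCovers x y) (hne : a ≠ a')
    (hz : z ∈ upperCovers a y ∩ upperCovers a' y)
    (hz' : z' ∈ upperCovers a y ∩ upperCovers a' y) : z = z' := by
  by_contra hzz
  have hg := hxy.2
  have hcard := hb.card_upperCovers_eq_rank hfac hxy
  obtain ⟨c, hc, hc'⟩ := exists_mem_notMem_of_card_lt_card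
    (by rw [card_pair hne]; omega : #({a, a'} : Finset P) < #(upperCovers x y))
  have hxa := (mem_upperCovers.1 ha).1
  have hxc := mem_upperCovers.1 hc
  have hga := hxa.grade_eq_add_one
  have hgc := hxc.1.grade_eq_add_one
  have hcov : ∀ w ∈ upperCovers a y ∩ upperCovers a' y,
      w ∈ intervalLevel x y 2 ∧ ¬ c ≤ w := by
    intro w hw
    simp only [mem_inter, mem_upperCovers] at hw
    have hgw := hw.1.1.grade_eq_add_one
    have hxw := hxa.le.trans hw.1.1.le
    refine ⟨mem_intervalLevel.2 ⟨hxw, hw.1.2, by omega⟩, fun hcw => ?_⟩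
    have h2 := hb.card_upperCovers_eq_rank (k := 2) (fun j hj => hfac j (by omega))
      (x := x) (y := w) ⟨hxw, by omega⟩
    have hss : insert c ({a, a'} : Finset P) ⊆ upperCovers x w := by
      simp only [insert_subset_iff, singleton_subset_iff, mem_upperCovers]
      exact ⟨⟨hxc.1, hcw⟩, ⟨hxa, hw.1.1.le⟩, ⟨(mem_upperCovers.1 ha').1, hw.2.1.le⟩⟩
    have := card_le_card hss
    rw [card_insert_of_notMem hc', card_pair hne] at this
    omega
  have hlev := hb.card_intervalLevel_mul (j := 2) hxy (by omega)
  rw [hfac 2 (by omega), hfac (3 - 2) (by omega), hfac 3 le_rfl] at hlev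
  simp only [Nat.factorial] at hlev
  have hcc := hb.card_upperCovers_eq_rank (k := 2) (fun j hj => hfac j (by omega))
      (x := c) (y := y) ⟨hxc.2, by omega⟩
  have hsub' : upperCovers c y ∪ {z, z'} ⊆ intervalLevel x y 2 := by
    refine union_subset (fun w hw => ?_) ?_
    · rw [mem_upperCovers] at hw
      have := hw.1.grade_eq_add_one
      exact mem_intervalLevel.2 ⟨hxc.1.le.trans hw.1.le, hw.2, by omega⟩
    · simp [insert_subset_iff, (hcov z hz).1, (hcov z' hz').1]
  have hdisj : Disjoint (upperCovers c y) {z, z'} := by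
    rw [disjoint_left]
    intro w hw hw'
    have hcw := (mem_upperCovers.1 hw).1.le
    rw [mem_insert, mem_singleton] at hw'
    rcases hw' with rfl | rfl
    · exact (hcov w hz).2 hcw
    · exact (hcov w hz').2 hcw
  have := card_le_card hsub'
  rw [card_union_of_disjoint hdisj, card_pair hzz] at this
  omega

/-- Each of the `k - 1` covers of `a` lies above exactly one other atom. By uniqueness these atoms
are distinct, so they are all the `k - 1` atoms other than `a`. -/
theorem exists_common_cover_of_unique (hb : IsFactorialFunction P b) {k : ℕ}
    (hfac : ∀ j ≤ k, b j = j.factorial) {x y : P} (hxy : IsIntervalOfRank k x y)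
    (huniq : ∀ a ∈ upperCovers x y, ∀ a' ∈ upperCovers x y, a ≠ a' →
      ∀ z ∈ upperCovers a y ∩ upperCovers a' y, ∀ z' ∈ upperCovers a y ∩ upperCovers a' y, z = z')
    {a a' : P} (ha : a ∈ upperCovers x y) (ha' : a' ∈ upperCovers x y) (hne : a ≠ a') :
    (upperCovers a y ∩ upperCovers a' y).Nonempty := by
  have hg := hxy.2
  obtain ⟨hxa, hay⟩ := mem_upperCovers.1 ha
  have hga := hxa.grade_eq_add_one
  have hgay := grade_mono (𝕆 := ℕ) hay
  have hone : ∀ w ∈ upperCovers a y, #((upperCovers x w).erase a) = 1 := by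
    intro w hw
    obtain ⟨haw, hwy⟩ := mem_upperCovers.1 hw
    have hgw := haw.grade_eq_add_one
    have hgwy := grade_mono (𝕆 := ℕ) hwy
    rw [card_erase_of_mem (mem_upperCovers.2 ⟨hxa, haw.le⟩),
      hb.card_upperCovers_eq_rank (k := 2) (fun j hj => hfac j (by omega))
        ⟨hxa.le.trans haw.le, by omega⟩]
  have hcov : ∀ {w c : P}, w ∈ upperCovers a y → c ∈ (upperCovers x w).erase a →
      c ∈ upperCovers x y ∧ c ≠ a ∧ w ∈ upperCovers a y ∩ upperCovers c y := by
    intro w c hw hc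
    rw [mem_erase, mem_upperCovers] at hc
    have hw' := mem_upperCovers.1 hw
    have h₁ := hw'.1.grade_eq_add_one
    have h₂ := hc.2.1.grade_eq_add_one
    exact ⟨mem_upperCovers.2 ⟨hc.2.1, hc.2.2.trans hw'.2⟩, hc.1, mem_inter.2 ⟨hw,
      mem_upperCovers.2 ⟨covBy_of_le_of_grade_eq hc.2.2 (by omega), hw'.2⟩⟩⟩
  have hdisj : ((upperCovers a y : Finset P) : Set P).PairwiseDisjoint
      fun w => (upperCovers x w).erase a := by
    intro w hw w' hw' hww
    rw [Function.onFun, disjoint_left]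
    intro c hc hc'
    have h₁ := hcov hw hc
    have h₂ := hcov hw' hc'
    exact hww (huniq a ha c h₁.1 h₁.2.1.symm w h₁.2.2 w' h₂.2.2)
  have hcard : #((upperCovers a y).biUnion fun w => (upperCovers x w).erase a) = k - 1 := by
    rw [card_biUnion hdisj, sum_congr rfl hone, ← card_eq_sum_ones]
    exact hb.card_upperCovers_eq_rank (fun j hj => hfac j (by omega)) ⟨hay, by omega⟩
  have hsub : ((upperCovers a y).biUnion fun w => (upperCovers x w).erase a) ⊆
      (upperCovers x y).erase a := by
    intro c hc
    obtain ⟨w, hw, hc⟩ := mem_biUnion.1 hc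
    have h := hcov hw hc
    exact mem_erase.2 ⟨h.2.1, h.1⟩
  have heq := eq_of_subset_of_card_le hsub (by
    rw [card_erase_of_mem ha, hb.card_upperCovers_eq_rank hfac hxy, hcard])
  have hmem : a' ∈ (upperCovers x y).erase a := mem_erase.2 ⟨hne.symm, ha'⟩
  rw [← heq] at hmem
  obtain ⟨w, hw, hc⟩ := mem_biUnion.1 hmem
  exact ⟨w, (hcov hw hc).2.2⟩

theorem common_cover_unique (hb : IsFactorialFunction P b) {k : ℕ}
    (hfac : ∀ j ≤ k, b j = j.factorial) {x y : P} (hxy : IsIntervalOfRank k x y) :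
    ∀ a ∈ upperCovers x y, ∀ a' ∈ upperCovers x y, a ≠ a' →
      ∀ z ∈ upperCovers a y ∩ upperCovers a' y, ∀ z' ∈ upperCovers a y ∩ upperCovers a' y,
        z = z' := by
  induction k generalizing x with
  | zero =>
    intro a ha
    obtain rfl : x = y := eq_of_le_of_grade_le hxy.1 hxy.2.le
    rw [mem_upperCovers] at ha
    exact (ha.2.not_gt ha.1.lt).elim
  | succ k ih =>
    intro a ha a' ha' hne z hz z' hz'
    have hg := hxy.2
    have hz₁ := mem_upperCovers.1 (mem_inter.1 hz).1
    have hz₂ := mem_upperCovers.1 (mem_inter.1 hz).2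
    have hz₁' := mem_upperCovers.1 (mem_inter.1 hz').1
    have hz₂' := mem_upperCovers.1 (mem_inter.1 hz').2
    have hxa := (mem_upperCovers.1 ha)
    have hga := hxa.1.grade_eq_add_one
    have hgz := hz₁.1.grade_eq_add_one
    have hgz' := hz₁'.1.grade_eq_add_one
    have hgzy := grade_mono (𝕆 := ℕ) hz₁.2
    rcases (by omega : k = 1 ∨ k = 2 ∨ 3 ≤ k) with rfl | rfl | hk
    · exact (eq_of_le_of_grade_le hz₁.2 (by omega)).trans
        (eq_of_le_of_grade_le hz₁'.2 (by omega)).symm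
    · exact hb.common_cover_unique_of_rank_three hfac hxy ha ha' hne hz hz'
    · by_contra hzz
      have hay : IsIntervalOfRank k a y := ⟨hxa.2, by omega⟩
      have hfac' : ∀ j ≤ k, b j = j.factorial := fun j hj => hfac j (by omega)
      -- Two common covers `z`, `z'` are atoms of `[a, y]`, so by induction they have a common cover
      -- `w`, and `[x, w]` contradicts the rank 3 case.
      obtain ⟨w, hw⟩ := hb.exists_common_cover_of_unique hfac' hay (ih hfac' hay)
        (mem_inter.1 hz).1 (mem_inter.1 hz').1 hzz
      rw [mem_inter, mem_upperCovers, mem_upperCovers] at hw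
      have hgw := hw.1.1.grade_eq_add_one
      have hzw := hw.1.1.le
      have hzw' := hw.2.1.le
      refine hzz (hb.common_cover_unique_of_rank_three (fun j hj => hfac j (by omega))
        (x := x) (y := w) ⟨hxa.1.le.trans (hz₁.1.le.trans hzw), by omega⟩ (a := a) (a' := a')
        ?_ ?_ hne ?_ ?_)
      · exact mem_upperCovers.2 ⟨hxa.1, hz₁.1.le.trans hzw⟩
      · exact mem_upperCovers.2 ⟨(mem_upperCovers.1 ha').1, hz₂.1.le.trans hzw⟩
      · exact mem_inter.2 ⟨mem_upperCovers.2 ⟨hz₁.1, hzw⟩, mem_upperCovers.2 ⟨hz₂.1, hzw⟩⟩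
      · exact mem_inter.2 ⟨mem_upperCovers.2 ⟨hz₁'.1, hzw'⟩, mem_upperCovers.2 ⟨hz₂'.1, hzw'⟩⟩

variable [BoundedOrder P] {n : ℕ}

theorem card_upperCovers_bot (hb : IsFactorialFunction P b) (hrank : grade ℕ (⊤ : P) = n)
    (hfac : ∀ j ≤ n, b j = j.factorial) (x : P) : #(upperCovers ⊥ x) = grade ℕ x := by
  have hbot : grade ℕ (⊥ : P) = 0 := grade_bot
  have hx : grade ℕ x ≤ n := hrank ▸ grade_mono (𝕆 := ℕ) (le_top : x ≤ ⊤)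
  exact hb.card_upperCovers_eq_rank (fun j hj => hfac j (by omega)) ⟨bot_le, by omega⟩

/-- This plays the role of the join of `u` and `a`. It is lifted from `v ⋖ u`: the cover of `v`
above `a` differs from `u`, and the two have a common cover. -/
theorem exists_cover_above_atom (hb : IsFactorialFunction P b) (hrank : grade ℕ (⊤ : P) = n)
    (hfac : ∀ j ≤ n, b j = j.factorial) {u y a : P} (huy : u ≤ y) (ha : a ∈ upperCovers ⊥ y)
    (hau : ¬ a ≤ u) : ∃ z ∈ upperCovers u y, a ≤ z := by
  induction u using WellFoundedLT.induction with
  | ind u ih =>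
    rcases eq_or_lt_of_le (bot_le : ⊥ ≤ u) with rfl | hu
    · exact ⟨a, ha, le_rfl⟩
    · obtain ⟨v, -, hvu⟩ := exists_le_covBy_of_lt hu
      obtain ⟨z, hz, haz⟩ := ih v hvu.lt (hvu.le.trans huy) fun h => hau (h.trans hvu.le)
      have hvy := hvu.le.trans huy
      have hg := grade_mono (𝕆 := ℕ) hvy
      have hgy : grade ℕ y ≤ n := hrank ▸ grade_mono (𝕆 := ℕ) (le_top : y ≤ ⊤)
      have hfac' : ∀ j ≤ grade ℕ y - grade ℕ v, b j = j.factorial :=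
        fun j hj => hfac j (by omega)
      have hint : IsIntervalOfRank (grade ℕ y - grade ℕ v) v y := ⟨hvy, by omega⟩
      obtain ⟨w, hw⟩ := hb.exists_common_cover_of_unique hfac' hint
        (hb.common_cover_unique hfac' hint) hz (mem_upperCovers.2 ⟨hvu, huy⟩)
        (by rintro rfl; exact hau haz)
      rw [mem_inter] at hw
      exact ⟨w, hw.2, haz.trans (mem_upperCovers.1 hw.1).1.le⟩

theorem cover_above_atom_unique (hb : IsFactorialFunction P b) (hrank : grade ℕ (⊤ : P) = n)
    (hfac : ∀ j ≤ n, b j = j.factorial) {u a z z' : P} (ha : ⊥ ⋖ a) (hau : ¬ a ≤ u)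
    (hz : u ⋖ z) (hz' : u ⋖ z') (haz : a ≤ z) (haz' : a ≤ z') : z = z' := by
  induction u using WellFoundedLT.induction generalizing z z' with
  | ind u ih =>
    rcases eq_or_lt_of_le (bot_le : ⊥ ≤ u) with rfl | hu
    · have h := ha.grade_eq_add_one
      have h₁ := hz.grade_eq_add_one
      have h₂ := hz'.grade_eq_add_one
      exact (eq_of_le_of_grade_le haz (by omega)).symm.trans
        (eq_of_le_of_grade_le haz' (by omega))
    · obtain ⟨v, -, hvu⟩ := exists_le_covBy_of_lt hu
      have hav : ¬ a ≤ v := fun h => hau (h.trans hvu.le)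
      obtain ⟨w, hw, haw⟩ := hb.exists_cover_above_atom hrank hfac (hvu.le.trans hz.le)
        (mem_upperCovers.2 ⟨ha, haz⟩) hav
      obtain ⟨w', hw', haw'⟩ := hb.exists_cover_above_atom hrank hfac (hvu.le.trans hz'.le)
        (mem_upperCovers.2 ⟨ha, haz'⟩) hav
      rw [mem_upperCovers] at hw hw'
      obtain rfl := ih v hvu.lt hav hw.1 hw'.1 haw haw'
      have hg := grade_mono (𝕆 := ℕ) (le_top : v ≤ ⊤)
      have g₁ := hvu.grade_eq_add_one
      have g₂ := hz.grade_eq_add_one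
      have g₃ := hz'.grade_eq_add_one
      have g₄ := hw.1.grade_eq_add_one
      refine hb.common_cover_unique (k := grade ℕ (⊤ : P) - grade ℕ v) (x := v) (y := ⊤)
        (fun j hj => hfac j (by omega)) ⟨le_top, by omega⟩ u (mem_upperCovers.2 ⟨hvu, le_top⟩)
        w (mem_upperCovers.2 ⟨hw.1, le_top⟩) (by rintro rfl; exact hau haw) z ?_ z' ?_
      · exact mem_inter.2 ⟨mem_upperCovers.2 ⟨hz, le_top⟩, mem_upperCovers.2
          ⟨covBy_of_le_of_grade_eq hw.2 (by omega), le_top⟩⟩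
      · exact mem_inter.2 ⟨mem_upperCovers.2 ⟨hz', le_top⟩, mem_upperCovers.2
          ⟨covBy_of_le_of_grade_eq hw'.2 (by omega), le_top⟩⟩

/-- If a maximal common lower bound `u` were below `x` strictly, an atom gained by a cover of `u`
under `x` would also lie below `y`. The unique cover of `u` above that atom would be a larger common
lower bound. -/
theorem upperCovers_bot_subset_iff (hb : IsFactorialFunction P b) (hrank : grade ℕ (⊤ : P) = n)
    (hfac : ∀ j ≤ n, b j = j.factorial) {x y : P} :
    upperCovers ⊥ x ⊆ upperCovers ⊥ y ↔ x ≤ y := by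
  refine ⟨fun h => ?_, upperCovers_subset⟩
  obtain ⟨u, hu⟩ := (Set.toFinite {u : P | u ≤ x ∧ u ≤ y}).exists_maximal
    ⟨⊥, bot_le, bot_le⟩
  obtain ⟨hux, huy⟩ := hu.prop
  rcases hux.eq_or_lt with rfl | hlt
  · exact huy
  exfalso
  obtain ⟨z, hz⟩ := upperCovers_nonempty hlt
  obtain ⟨huz, hzx⟩ := mem_upperCovers.1 hz
  obtain ⟨a, haz, hau⟩ := exists_mem_notMem_of_card_lt_card
    (by rw [hb.card_upperCovers_bot hrank hfac, hb.card_upperCovers_bot hrank hfac]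
        exact grade_strictMono huz.lt : #(upperCovers ⊥ u) < #(upperCovers ⊥ z))
  obtain ⟨ha, haz'⟩ := mem_upperCovers.1 haz
  have hau' : ¬ a ≤ u := fun h => hau (mem_upperCovers.2 ⟨ha, h⟩)
  obtain ⟨z', hz', haz''⟩ := hb.exists_cover_above_atom hrank hfac huy
    (h (upperCovers_subset hzx haz)) hau'
  obtain ⟨huz', hzy'⟩ := mem_upperCovers.1 hz'
  obtain rfl := hb.cover_above_atom_unique hrank hfac ha hau' huz huz' haz' haz''
  exact huz.lt.not_ge (hu.le_of_ge ⟨hzx, hzy'⟩ huz.le)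

theorem exists_upperCovers_bot_eq (hb : IsFactorialFunction P b) (hrank : grade ℕ (⊤ : P) = n)
    (hfac : ∀ j ≤ n, b j = j.factorial) (T : Finset P) (hT : T ⊆ upperCovers ⊥ ⊤) :
    ∃ x : P, upperCovers ⊥ x = T := by
  induction T using Finset.induction_on with
  | empty =>
    refine ⟨⊥, card_eq_zero.1 ?_⟩
    rw [hb.card_upperCovers_bot hrank hfac]
    exact grade_bot
  | insert a T haT ih =>
    rw [insert_subset_iff] at hT
    obtain ⟨x, rfl⟩ := ih hT.2
    obtain ⟨z, hz, haz⟩ := hb.exists_cover_above_atom hrank hfac (le_top : x ≤ ⊤) hT.1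
      fun h => haT (mem_upperCovers.2 ⟨(mem_upperCovers.1 hT.1).1, h⟩)
    have hxz := (mem_upperCovers.1 hz).1
    refine ⟨z, (eq_of_subset_of_card_le (insert_subset ?_ (upperCovers_subset hxz.le)) ?_).symm⟩
    · exact mem_upperCovers.2 ⟨(mem_upperCovers.1 hT.1).1, haz⟩
    · rw [card_insert_of_notMem haT, hb.card_upperCovers_bot hrank hfac,
        hb.card_upperCovers_bot hrank hfac, hxz.grade_eq_add_one]

theorem nonempty_orderIso_booleanLattice (hb : IsFactorialFunction P b)
    (hrank : grade ℕ (⊤ : P) = n) (hfac : ∀ j ≤ n, b j = j.factorial) :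
    Nonempty (P ≃o BooleanLattice n) := by
  let e : upperCovers (⊥ : P) ⊤ ≃ Fin n :=
    equivFinOfCardEq ((hb.card_upperCovers_bot hrank hfac ⊤).trans hrank)
  let f : P → BooleanLattice n := fun x => univ.filter fun i => (e.symm i : P) ≤ x
  have hf : ∀ x y, f x ≤ f y ↔ x ≤ y := by
    intro x y
    rw [← hb.upperCovers_bot_subset_iff hrank hfac]
    constructor
    · intro h a ha
      obtain ⟨h₁, h₂⟩ := mem_upperCovers.1 ha
      have hmem : e ⟨a, mem_upperCovers.2 ⟨h₁, le_top⟩⟩ ∈ f x := by simpa [f] using h₂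
      have := h hmem
      exact mem_upperCovers.2 ⟨h₁, by simpa [f] using this⟩
    · intro h i hi
      have h₁ := (mem_upperCovers.1 (e.symm i).2).1
      have h₂ : (e.symm i : P) ≤ x := by simpa [f] using hi
      have h₃ := (mem_upperCovers.1 (h (mem_upperCovers.2 ⟨h₁, h₂⟩))).2
      simpa [f] using h₃
  have hsurj : Function.Surjective f := by
    intro T
    obtain ⟨x, hx⟩ := hb.exists_upperCovers_bot_eq hrank hfac
      (T.image fun i => (e.symm i : P)) (by
        intro a ha
        obtain ⟨i, -, rfl⟩ := mem_image.1 ha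
        exact (e.symm i).2)
    refine ⟨x, ?_⟩
    ext i
    have h : (e.symm i : P) ∈ upperCovers ⊥ x ↔ (e.symm i : P) ≤ x := by
      rw [mem_upperCovers]
      exact and_iff_right (mem_upperCovers.1 (e.symm i).2).1
    have h' : i ∈ f x ↔ (e.symm i : P) ≤ x := by simp [f]
    rw [h', ← h, hx, mem_image]
    constructor
    · rintro ⟨j, hj, hij⟩
      rwa [← e.symm.injective (Subtype.ext hij)]
    · exact fun hi => ⟨i, hi, rfl⟩
  exact ⟨RelIso.ofSurjective (OrderEmbedding.ofMapLEIff f hf) hsurj⟩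

end IsFactorialFunction

end Boolean

end EulerianBinomial

/-! ### The classification -/

theorem theorem3p6 {P : Type*} [PartialOrder P] [BoundedOrder P] [Finite P] [GradeMinOrder ℕ P]
    (hB : IsBinomialPoset P) (hE : IsEulerianPoset P)
    (n m : ℕ) (hnm : n = 2 * m) (hn : 4 ≤ n) (hrank : grade ℕ (⊤ : P) = n) :
    Nonempty (P ≃o ButterflyPoset n) ∨ Nonempty (P ≃o BooleanLattice n) := by
  cases nonempty_fintype P
  obtain ⟨b, hb⟩ := hB.exists_isFactorialFunction
  -- This is where even rank is used: the induction in steps of two ends exactly at `n`.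
  obtain ⟨l, rfl⟩ : ∃ l, n = 2 * l + 2 := ⟨m - 1, by omega⟩
  rcases hb.map_three hE hrank hn with h | h
  · refine Or.inl (hb.nonempty_orderIso_butterflyPoset hrank (fun j hj => ?_) (by omega))
    exact hb.eq_two_pow hE hrank h l le_rfl j (by omega)
  · exact Or.inr (hb.nonempty_orderIso_booleanLattice hrank
      (hb.eq_factorial hE hrank h l le_rfl))
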